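/- Fix a universe of sets $V$ (in type theory: a type universe). For a complete Boolean algebra $\mathbb B\in V$, the class $V^{\mathbb B}$ of $\mathbb B$-valued sets is defined inductively: its elements are the triples $x=\langle\alpha,A,B\rangle$ of an index set $\alpha$, a map $A$ from $\alpha$ to $\mathbb B$-valued sets and a map $B:\alpha\to\mathbb B$. Equality and membership take values in $\mathbb B$: \[ [\![\langle\alpha,A,B\rangle=\langle\alpha',A',B'\rangle]\!]=\bigwedge_{a}\Big(B(a)\Rightarrow\bigvee_{a'}B'(a')\wedge[\![A(a)=A'(a')]\!]\Big)\wedge\bigwedge_{a'}\Big(B'(a')\Rightarrow\bigvee_{a}B(a)\wedge[\![A(a)=A'(a')]\!]\Big), \] \[ [\![x\in\langle\alpha,A,B\rangle]\!]=\bigvee_a B(a)\wedge[\![x=A(a)]\!], \] and the truth value $[\![\varphi]\!]\in\mathbb B$ of a first-order formula with parameters in $V^{\mathbb B}$ is computed by interpreting connectives and quantifiers by the operations of $\mathbb B$. The language of set theory has the relation symbol $\in$ and function symbols for $\varnothing$, $\omega$, ordered pairs, unions and power sets, interpreted in $V^{\mathbb B}$ in the standard way; in particular, for $x=\langle\alpha,A,B\rangle$,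 the power set is $\mathcal P(x)=\langle\mathbb B^{\alpha},\ \chi\mapsto\tilde\chi,\ \chi\mapsto[\![\tilde\chi\subseteq x]\!]\rangle$, where $\tilde\chi=\langle\alpha,A,\chi\rangle$. Every set $x\in V$ has a canonical name $\check x\in V^{\mathbb B}$, whose elements are the $\check y$ with $y\in x$, each with truth value $\top$; the symbol $\omega$ is interpreted by $\check\omega$. Cardinals of $V$ are identified with von Neumann ordinals. $\mathsf{CH}$ is the sentence $\forall x\,(\mathrm{Ord}(x)\rightarrow x\le\omega\vee\mathcal P(\omega)\le x)$, where $x\le y$ means that there is a surjection from a subset of $y$ onto $x$, and $\mathrm{Ord}(x)$ says that $x$ is transitive and that $\in$ is trichotomous and well-founded on $x$. Write $x\prec y$ for "there is no surjection from a subset of $x$ onto $y$". $\mathbb B$ has the countable chain condition (CCC) if every set of pairwise disjoint elements of $\mathbb B$ is countable. Let $\mathbb B_{\mathsf{cohen}}=\mathrm{RO}(2^{\aleph_2\times\mathbb N})$ be the complete Boolean algebra of regular open subsets of the product space $2^{\aleph_2\times\mathbb N}$. For $\nu\in\aleph_2$, the Cohen real $\tilde\chi_\nu\in V^{\mathbb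 B_{\mathsf{cohen}}}$ is the $\mathbb B_{\mathsf{cohen}}$-valued subset of $\check\omega$ in which $\check n$ has truth value $\{S\subseteq\aleph_2\times\mathbb N : (\nu,n)\in S\}$. Then: 1. In $V^{\mathbb B_{\mathsf{cohen}}}$, $[\![\neg\mathsf{CH}]\!]=\top$. 2. There is $f\in V^{\mathbb B_{\mathsf{cohen}}}$ such that $[\![f\text{ is an injection from }\check\aleph_2\text{ into }\mathcal P(\omega)]\!]=\top$ and $[\![(\check\nu,\tilde\chi_\nu)\in f]\!]=\top$ for all $\nu\in\aleph_2$. 3. $\mathbb B_{\mathsf{cohen}}$ has the CCC, and in $V^{\mathbb B_{\mathsf{cohen}}}$, $[\![\omega\prec\check\aleph_1]\!]=\top$ and $[\![\check\aleph_1\prec\check\aleph_2]\!]=\top$; in particular it is forced that there is no surjection from $\omega$ onto $\check\aleph_1$ and none from $\check\aleph_1$ onto $\check\aleph_2$. 4. More generally, for every complete Boolean algebra $\mathbb B\in V$ with the CCC and all infinite regular cardinals $\kappa_1<\kappa_2$, $[\![\check\kappa_1\prec\check\kappa_2]\!]=\top$ in $V^{\mathbb B}$. -/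

import Mathlib

universe u v w w'

/-! ### Complete Boolean algebras: the countable chain condition, regular open algebras -/

/-- The countable chain condition: every antichain (a set of pairwise disjoint elements)
is countable. -/
def CCC (𝔹 : Type u) [CompleteBooleanAlgebra 𝔹] : Prop :=
  ∀ A : Set 𝔹, (∀ a ∈ A, ∀ b ∈ A, a ≠ b → a ⊓ b = ⊥) → A.Countable

/-- The regular open algebra of a topological space: the open sets `U` with `U^⊥⊥ = U`, where
`U^⊥` (the pseudocomplement in the Heyting algebra of open sets) is the complement of the closure
of `U`; see `RO.coe_compl`. -/
abbrev RO (X : Type u) [TopologicalSpace X] : Type u :=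
  Heyting.Regular (TopologicalSpace.Opens X)

namespace RO

variable {X : Type u} [TopologicalSpace X]

theorem coe_compl (U : TopologicalSpace.Opens X) :
    ((Uᶜ : TopologicalSpace.Opens X) : Set X) = (closure (U : Set X))ᶜ := by
  rw [TopologicalSpace.Opens.coe_compl_eq_interior_compl, interior_compl]

/-- The order is inclusion; suprema are regularizations of unions. -/
noncomputable instance : CompleteBooleanAlgebra (RO X) where
  __ := (inferInstance : BooleanAlgebra (RO X))
  sSup := (Heyting.Regular.gi (α := TopologicalSpace.Opens X)).liftCompleteLattice.sSup
  sInf := (Heyting.Regular.gi (α := TopologicalSpace.Opens X)).liftCompleteLattice.sInf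
  isLUB_sSup := (Heyting.Regular.gi (α := TopologicalSpace.Opens X)).liftCompleteLattice.isLUB_sSup
  isGLB_sInf := (Heyting.Regular.gi (α := TopologicalSpace.Opens X)).liftCompleteLattice.isGLB_sInf

/-- A clopen set, as an element of the regular open algebra. -/
def ofClopen (s : Set X) (hs : IsClopen s) : RO X :=
  ⟨⟨s, hs.isOpen⟩, by
    apply TopologicalSpace.Opens.ext
    rw [coe_compl, coe_compl]
    simp [hs.isClosed.closure_eq, hs.compl.isClosed.closure_eq]⟩

end RO

/-! ### Boolean-valued structures for a first-order language -/

/-- A `𝔹`-valued `L`-structure on the type `M`. -/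
structure BStructure (L : FirstOrder.Language.{u, v}) (𝔹 : Type w) [CompleteBooleanAlgebra 𝔹]
    (M : Type w') where
  funMap : ∀ {n : ℕ}, L.Functions n → (Fin n → M) → M
  relMap : ∀ {n : ℕ}, L.Relations n → (Fin n → M) → 𝔹
  eq : M → M → 𝔹
  eq_refl : ∀ x, eq x x = ⊤
  eq_symm : ∀ x y, eq x y ≤ eq y x
  eq_trans : ∀ x y z, eq x y ⊓ eq y z ≤ eq x z
  fun_congr : ∀ {n : ℕ} (f : L.Functions n) (x y : Fin n → M),
    ⨅ i, eq (x i) (y i) ≤ eq (funMap f x) (funMap f y)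
  rel_congr : ∀ {n : ℕ} (R : L.Relations n) (x y : Fin n → M),
    (⨅ i, eq (x i) (y i)) ⊓ relMap R x ≤ relMap R y

namespace BStructure

variable {L : FirstOrder.Language.{u, v}} {𝔹 : Type w} [CompleteBooleanAlgebra 𝔹] {M : Type w'}

/-- The value of a term under an assignment of its variables. -/
def termVal (S : BStructure L 𝔹 M) {α : Type} (s : α → M) : L.Term α → M
  | .var i => s i
  | .func f ts => S.funMap f fun i => S.termVal s (ts i)

/-- The truth value of a formula with in-scope variables `0, …, n - 1` under an assignment. -/
def truth (S : BStructure L 𝔹 M) : ∀ {n : ℕ}, L.BoundedFormula Empty n → (Fin n → M) → 𝔹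
  | _, .falsum, _ => ⊥
  | _, .equal t₁ t₂, s =>
      S.eq (S.termVal (Sum.elim Empty.elim s) t₁) (S.termVal (Sum.elim Empty.elim s) t₂)
  | _, .rel R ts, s => S.relMap R fun i => S.termVal (Sum.elim Empty.elim s) (ts i)
  | _, .imp φ ψ, s => S.truth φ s ⇨ S.truth ψ s
  | _, .all φ, s => ⨅ x : M, S.truth φ (Fin.snoc s x)

/-- `Γ` forces the sentence `φ` in `S`. -/
def Forces (S : BStructure L 𝔹 M) (Γ : 𝔹) (φ : L.Sentence) : Prop :=
  Γ ≤ S.truth φ Fin.elim0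

end BStructure

/-! ### The language of set theory and the continuum hypothesis -/

/-- The function symbols `∅`, `ω` (constants), `𝒫`, `⋃` (unary) and ordered pairing (binary). -/
inductive ZFCFunc : ℕ → Type
  | empty : ZFCFunc 0
  | omega : ZFCFunc 0
  | powerset : ZFCFunc 1
  | union : ZFCFunc 1
  | pair : ZFCFunc 2

/-- The only relation symbol is binary membership. -/
inductive ZFCRel : ℕ → Type
  | mem : ZFCRel 2

/-- The language of set theory. -/
def LZFC : FirstOrder.Language.{0, 0} := ⟨ZFCFunc, ZFCRel⟩

namespace LZFC

open FirstOrder FirstOrder.Language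

/-- Terms in the in-scope variables `0, …, n - 1`. -/
abbrev Tm (n : ℕ) : Type := LZFC.Term (Empty ⊕ Fin n)

/-- Formulas in the in-scope variables `0, …, n - 1`. -/
abbrev Fm (n : ℕ) : Type := LZFC.BoundedFormula Empty n

variable {n : ℕ}

/-- The variable bound by the innermost of the `n + 1` quantifiers in scope. -/
def last (n : ℕ) : Tm (n + 1) := Term.var (Sum.inr (Fin.last n))

/-- The term `t` viewed below one more quantifier. -/
def up (t : Tm n) : Tm (n + 1) := t.relabel (Sum.map id Fin.castSucc)

def emptyT : Tm n := Term.func (L := LZFC) ZFCFunc.empty ![]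
def omegaT : Tm n := Term.func (L := LZFC) ZFCFunc.omega ![]
def powersetT (t : Tm n) : Tm n := Term.func (L := LZFC) ZFCFunc.powerset ![t]
def pairT (s t : Tm n) : Tm n := Term.func (L := LZFC) ZFCFunc.pair ![s, t]

def memF (s t : Tm n) : Fm n := BoundedFormula.rel (L := LZFC) ZFCRel.mem ![s, t]
def eqF (s t : Tm n) : Fm n := BoundedFormula.equal s t

/-- `∀ x ∈ t, φ x`, where `φ` has `x` as its last variable. -/
def ballF (t : Tm n) (φ : Fm (n + 1)) : Fm n := ((memF (last n) (up t)).imp φ).all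

/-- `∃ x ∈ t, φ x`, where `φ` has `x` as its last variable. -/
def bexF (t : Tm n) (φ : Fm (n + 1)) : Fm n := (memF (last n) (up t) ⊓ φ).ex

/-- `s ⊆ t` -/
def subsetF (s t : Tm n) : Fm n := ballF s (memF (last n) (up t))

/-- `z` is transitive: `∀ x ∈ z, x ⊆ z`. -/
def transitiveF (z : Tm n) : Fm n := ballF z (subsetF (last n) (up z))

/-- `∀ x ∈ z, ∀ y ∈ z, x = y ∨ x ∈ y ∨ y ∈ x` -/
def trichotomyF (z : Tm n) : Fm n :=
  ballF z <| ballF (up z) <|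
    let x : Tm (n + 2) := up (last n)
    let y : Tm (n + 2) := last (n + 1)
    eqF x y ⊔ (memF x y ⊔ memF y x)

/-- `∀ x, x ⊆ z → x ≠ ∅ → ∃ y ∈ x, ∀ w ∈ x, w ∉ y` -/
def wellFoundedF (z : Tm n) : Fm n :=
  BoundedFormula.all <|
    let x : Tm (n + 1) := last n
    (subsetF x (up z)).imp <| (eqF x emptyT).not.imp <|
      bexF x <| ballF (up x) <|
        let y : Tm (n + 3) := up (last (n + 1))
        let w : Tm (n + 3) := last (n + 2)
        (memF w y).not

/-- `z` is an ordinal. -/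
def ordF (z : Tm n) : Fm n := trichotomyF z ⊓ (wellFoundedF z ⊓ transitiveF z)

/-- `f` is a function from `x` to `y`: a set of pairs `(a, b)` with `a ∈ x` and `b ∈ y`,
total on `x` and single-valued. -/
def funF (x y f : Tm n) : Fm n :=
  ballF f (bexF (up x) (bexF (up (up y))
      (eqF (up (up (last n))) (pairT (up (last (n + 1))) (last (n + 2)))))) ⊓
  (ballF x (bexF (up y) (memF (pairT (up (last n)) (last (n + 1))) (up (up f)))) ⊓
  ballF x (ballF (up y) (ballF (up (up y))
    (let a : Tm (n + 3) := up (up (last n))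
     let b : Tm (n + 3) := up (last (n + 1))
     let c : Tm (n + 3) := last (n + 2)
     let f' : Tm (n + 3) := up (up (up f))
     (memF (pairT a b) f').imp ((memF (pairT a c) f').imp (eqF b c))))))

/-- `∀ b ∈ y, ∃ a ∈ x, (a, b) ∈ f` -/
def ontoF (x y f : Tm n) : Fm n :=
  ballF y (bexF (up x) (memF (pairT (last (n + 1)) (up (last n))) (up (up f))))

/-- `x ≤ y`: there is a surjection `f` from a subset `s` of `y` to `x`. -/
def leF (x y : Tm n) : Fm n :=
  BoundedFormula.ex <| BoundedFormula.ex <|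
    let s : Tm (n + 2) := up (last n)
    let f : Tm (n + 2) := last (n + 1)
    subsetF s (up (up y)) ⊓ (funF s (up (up x)) f ⊓ ontoF s (up (up x)) f)

/-- The continuum hypothesis: `∀ x, Ord x → x ≤ ω ∨ 𝒫 ω ≤ x`. -/
def CH : LZFC.Sentence :=
  BoundedFormula.all <|
    (ordF (last 0)).imp (leF (last 0) omegaT ⊔ leF (powersetT omegaT) (last 0))

end LZFC

/-! ### Boolean-valued sets -/

/-- `𝔹`-valued sets (`𝔹`-names). -/
inductive BSet (𝔹 : Type u) : Type (u + 1)
  | mk (α : Type u) (A : α → BSet 𝔹) (B : α → 𝔹) : BSet 𝔹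

namespace BSet

variable {𝔹 : Type u}

/-- The index type of a `𝔹`-valued set. -/
def idx : BSet 𝔹 → Type u
  | mk α _ _ => α

/-- The elements of a `𝔹`-valued set. -/
def func : ∀ x : BSet 𝔹, x.idx → BSet 𝔹
  | mk _ A _ => A

/-- The truth values attached to the elements of a `𝔹`-valued set. -/
def bval : ∀ x : BSet 𝔹, x.idx → 𝔹
  | mk _ _ B => B

variable [CompleteBooleanAlgebra 𝔹]

/-- `𝔹`-valued equality. -/
def bvEq : BSet 𝔹 → BSet 𝔹 → 𝔹
  | mk α A B, mk α' A' B' =>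
    (⨅ a : α, B a ⇨ ⨆ a' : α', B' a' ⊓ bvEq (A a) (A' a')) ⊓
    (⨅ a' : α', B' a' ⇨ ⨆ a : α, B a ⊓ bvEq (A a) (A' a'))

/-- `𝔹`-valued membership. -/
def mem (x y : BSet 𝔹) : 𝔹 := ⨆ a : y.idx, y.bval a ⊓ bvEq x (y.func a)

/-- `𝔹`-valued inclusion. -/
def subset (x y : BSet 𝔹) : 𝔹 := ⨅ a : x.idx, x.bval a ⇨ mem (x.func a) y

/-- The canonical name of a set of the ground universe. -/
def check : PSet.{u} → BSet 𝔹
  | PSet.mk α A => mk α (fun a => check (A a)) (fun _ => ⊤)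

/-- The empty set. -/
def empty : BSet 𝔹 := mk PEmpty PEmpty.elim PEmpty.elim

/-- The set of natural numbers. -/
def omega : BSet 𝔹 := check PSet.omega

/-- The unordered pair `{x, y}`. -/
def upair (x y : BSet 𝔹) : BSet 𝔹 := mk (ULift Bool) (fun b => cond b.down x y) (fun _ => ⊤)

/-- The (Kuratowski) ordered pair `(x, y) = {{x}, {x, y}}`. -/
def pair (x y : BSet 𝔹) : BSet 𝔹 := upair (upair x x) (upair x y)

/-- The union `⋃ u`. -/
def sUnion (u : BSet 𝔹) : BSet 𝔹 :=
  mk (Σ a : u.idx, (u.func a).idx) (fun p => (u.func p.1).func p.2)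
    (fun p => u.bval p.1 ⊓ (u.func p.1).bval p.2)

/-- The `𝔹`-valued subset of `x` with the `𝔹`-valued indicator function `χ`. -/
def ofIndicator (x : BSet 𝔹) (χ : x.idx → 𝔹) : BSet 𝔹 := mk x.idx x.func χ

/-- The powerset of `x`. -/
def powerset (x : BSet 𝔹) : BSet 𝔹 :=
  mk (x.idx → 𝔹) (fun χ => x.ofIndicator χ) (fun χ => subset (x.ofIndicator χ) x)

/-! The laws that make these operations a `𝔹`-valued structure. -/

theorem bvEq_def (x y : BSet 𝔹) : bvEq x y =
    (⨅ a : x.idx, x.bval a ⇨ ⨆ b : y.idx, y.bval b ⊓ bvEq (x.func a) (y.func b)) ⊓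
    (⨅ b : y.idx, y.bval b ⇨ ⨆ a : x.idx, x.bval a ⊓ bvEq (x.func a) (y.func b)) := by
  cases x; cases y; rw [bvEq]; rfl

theorem bvEq_refl (x : BSet 𝔹) : bvEq x x = ⊤ := by
  induction x with
  | mk α A B ih =>
    rw [bvEq, eq_top_iff]
    refine le_inf (le_iInf fun a => ?_) (le_iInf fun a => ?_) <;>
    · rw [le_himp_iff, top_inf_eq]
      exact le_iSup_of_le a (by rw [ih, inf_top_eq])

theorem bvEq_symm (x y : BSet 𝔹) : bvEq x y = bvEq y x := by
  induction x generalizing y with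
  | mk α A B ih =>
    cases y with
    | mk α' A' B' => rw [bvEq, bvEq, inf_comm]; simp only [ih]

theorem bvEq_eq (x y : BSet 𝔹) : bvEq x y = subset x y ⊓ subset y x := by
  rw [bvEq_def]
  unfold subset mem
  simp only [bvEq_symm (y.func _) (x.func _)]

theorem bvEq_le_mem (x y : BSet 𝔹) (a : x.idx) : bvEq x y ⊓ x.bval a ≤ mem (x.func a) y := by
  rw [bvEq_eq, ← le_himp_iff]
  exact inf_le_left.trans (iInf_le _ a)

theorem bvEq_trans (x y z : BSet 𝔹) : bvEq x y ⊓ bvEq y z ≤ bvEq x z := by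
  induction x generalizing y z with
  | mk α A B ih =>
    have key : ∀ (a : α) (y z : BSet 𝔹),
        mem (A a) y ⊓ bvEq y z ≤ mem (A a) z := by
      intro a y z
      unfold mem
      rw [iSup_inf_eq]
      refine iSup_le fun b => ?_
      have h := bvEq_le_mem y z b
      calc y.bval b ⊓ bvEq (A a) (y.func b) ⊓ bvEq y z
          ≤ bvEq (A a) (y.func b) ⊓ (bvEq y z ⊓ y.bval b) := by
            refine le_inf (inf_le_left.trans inf_le_right)
              (le_inf inf_le_right (inf_le_left.trans inf_le_left))
        _ ≤ bvEq (A a) (y.func b) ⊓ mem (y.func b) z := inf_le_inf_left _ h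
        _ ≤ _ := by
            unfold mem
            rw [inf_iSup_eq]
            refine iSup_le fun c => le_iSup_of_le c ?_
            refine le_inf (inf_le_right.trans inf_le_left) ?_
            exact le_trans (inf_le_inf_left _ inf_le_right) (ih a _ _)
    rw [bvEq_def (mk α A B) z]
    apply le_inf
    · refine le_iInf fun (a : α) => ?_
      rw [le_himp_iff]
      refine le_trans ?_ (key a y z)
      exact le_inf (le_trans (inf_le_inf_right _ inf_le_left) (bvEq_le_mem (mk α A B) y a))
        (inf_le_left.trans inf_le_right)
    · refine le_iInf fun c => ?_
      rw [le_himp_iff]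
      have h1 : bvEq y z ⊓ z.bval c ≤ ⨆ b : y.idx, y.bval b ⊓ bvEq (y.func b) (z.func c) := by
        rw [← le_himp_iff, bvEq_def]
        exact inf_le_right.trans (iInf_le _ c)
      have h2 : ∀ b : y.idx, bvEq (mk α A B) y ⊓ y.bval b ≤
          ⨆ a : α, B a ⊓ bvEq (A a) (y.func b) := by
        intro b
        rw [← le_himp_iff, bvEq_def]
        exact inf_le_right.trans (iInf_le _ b)
      calc bvEq (mk α A B) y ⊓ bvEq y z ⊓ z.bval c
          ≤ bvEq (mk α A B) y ⊓ ⨆ b : y.idx, y.bval b ⊓ bvEq (y.func b) (z.func c) := by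
            rw [inf_assoc]; exact inf_le_inf_left _ h1
        _ ≤ _ := by
            rw [inf_iSup_eq]
            refine iSup_le fun b => ?_
            rw [← inf_assoc]
            refine (inf_le_inf_right _ (h2 b)).trans ?_
            rw [iSup_inf_eq]
            refine iSup_le fun a => le_iSup_of_le a ?_
            rw [inf_assoc]
            exact inf_le_inf_left _ (ih a _ _)

theorem mem_congr_left (x x' y : BSet 𝔹) : bvEq x x' ⊓ mem x y ≤ mem x' y := by
  unfold mem
  rw [inf_iSup_eq]
  refine iSup_le fun b => le_iSup_of_le b ?_
  refine le_inf (inf_le_right.trans inf_le_left) (le_trans ?_ (bvEq_trans x' x (y.func b)))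
  exact le_inf (inf_le_left.trans (bvEq_symm x x').le) (inf_le_right.trans inf_le_right)

theorem mem_congr_right (x y y' : BSet 𝔹) : bvEq y y' ⊓ mem x y ≤ mem x y' := by
  conv_lhs => unfold mem
  rw [inf_iSup_eq]
  refine iSup_le fun b => le_trans ?_ (mem_congr_left (y.func b) x y')
  refine le_inf (inf_le_right.trans (inf_le_right.trans (bvEq_symm _ _).le)) ?_
  exact le_trans (inf_le_inf_left _ inf_le_left) (bvEq_le_mem y y' b)

theorem bval_le_mem (x : BSet 𝔹) (a : x.idx) : x.bval a ≤ mem (x.func a) x :=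
  le_iSup_of_le a (by rw [bvEq_refl, inf_top_eq])

theorem subset_eq (x y : BSet 𝔹) : subset x y = ⨅ z : BSet 𝔹, mem z x ⇨ mem z y := by
  apply le_antisymm
  · refine le_iInf fun z => ?_
    rw [le_himp_iff]
    conv_lhs => unfold mem
    rw [inf_iSup_eq]
    refine iSup_le fun a => le_trans ?_ (mem_congr_left (x.func a) z y)
    refine le_inf (inf_le_right.trans (inf_le_right.trans (bvEq_symm _ _).le)) ?_
    refine le_trans (inf_le_inf_left _ inf_le_left) ?_
    rw [← le_himp_iff]
    exact iInf_le _ a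
  · refine le_iInf fun a => (iInf_le _ (x.func a)).trans ?_
    exact himp_le_himp_right (bval_le_mem x a)

theorem bvEq_le_subset (x y : BSet 𝔹) : bvEq x y ≤ subset x y := by
  rw [bvEq_eq]; exact inf_le_left

/-- Extensionality: sets with the same elements (below `Γ`) are equal (below `Γ`). -/
theorem bvEq_of_subset {Γ : 𝔹} {x y : BSet 𝔹} (h₁ : ∀ z, Γ ⊓ mem z x ≤ mem z y)
    (h₂ : ∀ z, Γ ⊓ mem z y ≤ mem z x) : Γ ≤ bvEq x y := by
  rw [bvEq_eq, subset_eq, subset_eq]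
  exact le_inf (le_iInf fun z => le_himp_iff.2 (h₁ z)) (le_iInf fun z => le_himp_iff.2 (h₂ z))

theorem mem_upair (z x y : BSet 𝔹) : mem z (upair x y) = bvEq z x ⊔ bvEq z y := by
  apply le_antisymm
  · refine iSup_le fun b => ?_
    obtain ⟨b⟩ := b
    cases b
    · exact inf_le_right.trans le_sup_right
    · exact inf_le_right.trans le_sup_left
  · refine sup_le ?_ ?_
    · exact le_iSup_of_le (ULift.up true) (le_inf le_top le_rfl)
    · exact le_iSup_of_le (ULift.up false) (le_inf le_top le_rfl)

theorem upair_congr (x y x' y' : BSet 𝔹) :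
    bvEq x x' ⊓ bvEq y y' ≤ bvEq (upair x y) (upair x' y') := by
  have key : ∀ x y x' y' z : BSet 𝔹,
      bvEq x x' ⊓ bvEq y y' ⊓ mem z (upair x y) ≤ mem z (upair x' y') := by
    intro x y x' y' z
    rw [mem_upair, mem_upair, inf_sup_left]
    refine sup_le (le_sup_of_le_left ?_) (le_sup_of_le_right ?_)
    · exact le_trans (le_inf inf_le_right (inf_le_left.trans inf_le_left)) (bvEq_trans z x x')
    · exact le_trans (le_inf inf_le_right (inf_le_left.trans inf_le_right)) (bvEq_trans z y y')
  refine bvEq_of_subset (key x y x' y') fun z => ?_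
  rw [bvEq_symm x, bvEq_symm y]
  exact key x' y' x y z

theorem pair_congr (x y x' y' : BSet 𝔹) :
    bvEq x x' ⊓ bvEq y y' ≤ bvEq (pair x y) (pair x' y') := by
  refine le_trans (le_inf ?_ (upair_congr x y x' y')) (upair_congr _ _ _ _)
  exact le_trans (le_inf inf_le_left inf_le_left) (upair_congr x x x' x')

theorem mem_sUnion (z u : BSet 𝔹) : mem z (sUnion u) = ⨆ y : BSet 𝔹, mem y u ⊓ mem z y := by
  apply le_antisymm
  · refine iSup_le fun p => le_iSup_of_le (u.func p.1) ?_
    refine le_inf ?_ ?_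
    · exact inf_le_left.trans (inf_le_left.trans (bval_le_mem u p.1))
    · exact le_iSup_of_le p.2 (inf_le_inf_right _ inf_le_right)
  · refine iSup_le fun y => ?_
    conv_lhs => enter [1]; unfold mem
    rw [iSup_inf_eq]
    refine iSup_le fun a => ?_
    calc u.bval a ⊓ bvEq y (u.func a) ⊓ mem z y
        ≤ u.bval a ⊓ mem z (u.func a) := by
          rw [inf_assoc]; exact inf_le_inf_left _ (mem_congr_right _ _ _)
      _ ≤ _ := by
          unfold mem
          rw [inf_iSup_eq]
          refine iSup_le fun b => le_iSup_of_le (⟨a, b⟩ : Σ a : u.idx, (u.func a).idx) ?_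
          rw [← inf_assoc]
          exact le_rfl

theorem sUnion_congr (u v : BSet 𝔹) : bvEq u v ≤ bvEq (sUnion u) (sUnion v) := by
  have key : ∀ u v z : BSet 𝔹, bvEq u v ⊓ mem z (sUnion u) ≤ mem z (sUnion v) := by
    intro u v z
    rw [mem_sUnion, mem_sUnion, inf_iSup_eq]
    refine iSup_le fun y => le_iSup_of_le y ?_
    rw [← inf_assoc]
    exact inf_le_inf_right _ (mem_congr_right _ _ _)
  refine bvEq_of_subset (key u v) fun z => ?_
  rw [bvEq_symm u]
  exact key v u z

theorem mem_powerset (z x : BSet 𝔹) : mem z (powerset x) = subset z x := by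
  apply le_antisymm
  · refine iSup_le fun χ => ?_
    change subset (x.ofIndicator χ) x ⊓ bvEq z (x.ofIndicator χ) ≤ _
    rw [subset_eq, subset_eq]
    refine le_iInf fun w => ?_
    rw [le_himp_iff]
    refine le_trans (b := (mem w (x.ofIndicator χ) ⇨ mem w x) ⊓ mem w (x.ofIndicator χ)) ?_
      himp_inf_le
    refine le_inf (inf_le_left.trans (inf_le_left.trans (iInf_le _ w))) ?_
    exact le_trans (inf_le_inf_right _ inf_le_right) (mem_congr_right _ _ _)
  · change _ ≤ ⨆ χ : x.idx → 𝔹, subset (x.ofIndicator χ) x ⊓ bvEq z (x.ofIndicator χ)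
    refine le_iSup_of_le (fun a => x.bval a ⊓ mem (x.func a) z) ?_
    · refine le_inf ?_ (bvEq_of_subset (fun w => ?_) fun w => ?_)
      · refine le_iInf fun a => ?_
        rw [le_himp_iff]
        exact inf_le_right.trans (inf_le_left.trans (bval_le_mem x a))
      · have h : subset z x ⊓ mem w z ≤ mem w x ⊓ mem w z := by
          refine le_inf ?_ inf_le_right
          rw [← le_himp_iff, subset_eq]
          exact iInf_le _ w
        refine h.trans ?_
        conv_lhs => enter [1]; unfold mem
        rw [iSup_inf_eq]
        refine iSup_le fun a => le_iSup_of_le a ?_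
        change _ ≤ (x.bval a ⊓ mem (x.func a) z) ⊓ bvEq w (x.func a)
        refine le_inf (le_inf (inf_le_left.trans inf_le_left) ?_) (inf_le_left.trans inf_le_right)
        exact le_trans (inf_le_inf_right _ inf_le_right) (mem_congr_left _ _ _)
      · refine inf_le_right.trans (iSup_le fun a => ?_)
        change (x.bval a ⊓ mem (x.func a) z) ⊓ bvEq w (x.func a) ≤ _
        refine le_trans ?_ (mem_congr_left (x.func a) w z)
        exact le_inf (inf_le_right.trans (bvEq_symm _ _).le) (inf_le_left.trans inf_le_right)

theorem powerset_congr (x y : BSet 𝔹) : bvEq x y ≤ bvEq (powerset x) (powerset y) := by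
  have key : ∀ x y z : BSet 𝔹, bvEq x y ⊓ mem z (powerset x) ≤ mem z (powerset y) := by
    intro x y z
    rw [mem_powerset, mem_powerset, subset_eq, subset_eq]
    refine le_iInf fun w => ?_
    rw [le_himp_iff]
    refine le_trans (b := bvEq x y ⊓ mem w x) ?_ (mem_congr_right _ _ _)
    refine le_inf (inf_le_left.trans inf_le_left) ?_
    exact le_trans (inf_le_inf_right _ (inf_le_right.trans (iInf_le _ w))) himp_inf_le
  refine bvEq_of_subset (key x y) fun z => ?_
  rw [bvEq_symm x]
  exact key y x z

/-! ### Functions between `𝔹`-valued sets -/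

/-- The truth value of "`f` is a function from `x` to `y`": `f` is a set of pairs `(a, b)` with
`a ∈ x` and `b ∈ y`, total on `x` and single-valued. -/
def isFun (x y f : BSet 𝔹) : 𝔹 :=
  (⨅ p : BSet 𝔹, mem p f ⇨
    ⨆ a : BSet 𝔹, mem a x ⊓ ⨆ b : BSet 𝔹, mem b y ⊓ bvEq p (pair a b)) ⊓
  ((⨅ a : BSet 𝔹, mem a x ⇨ ⨆ b : BSet 𝔹, mem b y ⊓ mem (pair a b) f) ⊓
  (⨅ a : BSet 𝔹, mem a x ⇨ ⨅ b : BSet 𝔹, mem b y ⇨ ⨅ c : BSet 𝔹, mem c y ⇨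
    (mem (pair a b) f ⇨ mem (pair a c) f ⇨ bvEq b c)))

/-- The truth value of "every element of `y` is an `f`-image of an element of `x`". -/
def isOnto (x y f : BSet 𝔹) : 𝔹 :=
  ⨅ b : BSet 𝔹, mem b y ⇨ ⨆ a : BSet 𝔹, mem a x ⊓ mem (pair a b) f

/-- The truth value of "elements of `x` with the same `f`-image in `y` are equal". -/
def isOneOne (x y f : BSet 𝔹) : 𝔹 :=
  ⨅ a : BSet 𝔹, mem a x ⇨ ⨅ a' : BSet 𝔹, mem a' x ⇨ ⨅ b : BSet 𝔹, mem b y ⇨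
    (mem (pair a b) f ⇨ mem (pair a' b) f ⇨ bvEq a a')

/-- The truth value of "`f` is an injection from `x` into `y`". -/
def isInjection (x y f : BSet 𝔹) : 𝔹 := isFun x y f ⊓ isOneOne x y f

/-- The truth value of "`f` is a surjection from `x` onto `y`". -/
def isSurjection (x y f : BSet 𝔹) : 𝔹 := isFun x y f ⊓ isOnto x y f

/-- The truth value of `x ≺ y`: there is no surjection from a subset of `x` onto `y`. -/
def prec (x y : BSet 𝔹) : 𝔹 :=
  (⨆ s : BSet 𝔹, ⨆ f : BSet 𝔹, subset s x ⊓ isSurjection s y f)ᶜ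

/-! ### The Boolean-valued universe as a structure for the language of set theory -/

/-- The interpretation of the function symbols. -/
def interp : ∀ {n : ℕ}, ZFCFunc n → (Fin n → BSet 𝔹) → BSet 𝔹
  | _, .empty, _ => empty
  | _, .omega, _ => omega
  | _, .powerset, x => powerset (x 0)
  | _, .union, x => sUnion (x 0)
  | _, .pair, x => pair (x 0) (x 1)

/-- The interpretation of the relation symbol. -/
def interpRel : ∀ {n : ℕ}, ZFCRel n → (Fin n → BSet 𝔹) → 𝔹
  | _, .mem, x => mem (x 0) (x 1)

end BSet

/-- The `𝔹`-valued universe of sets, as a `𝔹`-valued structure. -/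
def VB (𝔹 : Type u) [CompleteBooleanAlgebra 𝔹] : BStructure LZFC 𝔹 (BSet 𝔹) where
  funMap := BSet.interp
  relMap := BSet.interpRel
  eq := BSet.bvEq
  eq_refl := BSet.bvEq_refl
  eq_symm x y := (BSet.bvEq_symm x y).le
  eq_trans := BSet.bvEq_trans
  fun_congr f x y := by
    cases f with
    | empty => exact le_top.trans (BSet.bvEq_refl _).ge
    | omega => exact le_top.trans (BSet.bvEq_refl _).ge
    | powerset => exact (iInf_le _ 0).trans (BSet.powerset_congr _ _)
    | union => exact (iInf_le _ 0).trans (BSet.sUnion_congr _ _)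
    | pair => exact (le_inf (iInf_le _ 0) (iInf_le _ 1)).trans (BSet.pair_congr _ _ _ _)
  rel_congr R x y := by
    cases R with
    | mem =>
      refine le_trans ?_ (BSet.mem_congr_left (x 0) (y 0) (y 1))
      refine le_inf (inf_le_left.trans (iInf_le _ 0)) (le_trans ?_ (BSet.mem_congr_right _ (x 1) _))
      exact inf_le_inf_right _ (iInf_le _ 1)

/-! ### Cohen forcing -/

/-- The canonical name of the (von Neumann) ordinal of the ground universe that represents the
cardinal `κ`. -/
noncomputable def BSet.checkCard {𝔹 : Type u} [CompleteBooleanAlgebra 𝔹] (κ : Cardinal.{u}) :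
    BSet 𝔹 :=
  BSet.check κ.ord.toPSet

/-- The von Neumann ordinal `ℵ₂` of the ground universe. -/
noncomputable def aleph2 : PSet.{u} := (Cardinal.aleph 2).ord.toPSet

/-- The Cohen algebra `RO(2^(ℵ₂ × ℕ))`, with the product topology on `2^(ℵ₂ × ℕ)`. -/
abbrev BCohen : Type u := RO (aleph2.{u}.Type × ℕ → Bool)

/-- The regular open set of all subsets of `ℵ₂ × ℕ` that contain `(ν, n)`. -/
def principalOpen (ν : aleph2.{u}.Type) (n : ℕ) : BCohen.{u} :=
  RO.ofClopen {S | S (ν, n) = true}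
    ((isClopen_discrete {true}).preimage (continuous_apply (ν, n)))

/-- The Cohen real of `ν`: the `𝔹`-valued subset of `ω` with indicator function
`n ↦ principalOpen ν n`. -/
noncomputable def cohenReal (ν : aleph2.{u}.Type) : BSet BCohen.{u} :=
  BSet.ofIndicator BSet.omega fun n : ULift ℕ => principalOpen ν n.down

/-! Everything rests on one counting argument. Suppose `Γ` forces that `f` is a surjection from a
subset of `check z` onto `y`, where `y` has a family of certain members `c j` that are pairwise
unequal with value `⊤`. Under the CCC, single-valuedness of `f` leaves each `a` in `z` only
countably many possible values `c j`. If there are more than `max #z ℵ₀` indices `j`, some `c j` is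
a possible value of no `a`, so surjectivity makes `Γ = ⊥` (`CCC.eq_bot_of_forall_le_iSup`,
`subset_inf_isSurjection_eq_bot`).

With canonical names of ordinals as the `c j`, this gives `κ₁ ≺ κ₂`. With the Cohen reals it gives
`ℵ₁ ≺ 𝒫 ω`. Together with `ω ≺ ℵ₁` and the fact that the name of an ordinal is an ordinal
(`truth_ordF_check`), this makes `ℵ₁` a counterexample to CH.

Two facts about the Cohen algebra are needed. Its CCC comes from the coin-tossing measure on the
Cantor cube (`ccc_cantorCube`). Distinct Cohen reals are unequal with value `⊤` because a nonempty
open set constrains only finitely many coordinates near a point, leaving room to separate them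
(`bvEq_cohenReal`). -/

open Cardinal

/-! ### Forcing calculus in a complete Boolean algebra -/

section Calculus

variable {𝔹 : Type u} [CompleteBooleanAlgebra 𝔹]

/-- Elimination rule of a sequent calculus with contexts in `𝔹`: by distributivity, an existential
may be instantiated after shrinking the context `Γ` to some `Δ`. The next lemmas are the analogous
rules for `⊔` and `⇨`. -/
theorem le_of_le_iSup {ι : Sort*} {Γ r : 𝔹} {p : ι → 𝔹} (h : Γ ≤ ⨆ i, p i)
    (H : ∀ i, ∀ Δ ≤ Γ, Δ ≤ p i → Δ ≤ r) : Γ ≤ r := by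
  rw [← inf_eq_left.2 h, inf_iSup_eq]
  exact iSup_le fun i => H i _ inf_le_left inf_le_right

theorem le_of_le_sup {Γ r p q : 𝔹} (h : Γ ≤ p ⊔ q) (H₁ : ∀ Δ ≤ Γ, Δ ≤ p → Δ ≤ r)
    (H₂ : ∀ Δ ≤ Γ, Δ ≤ q → Δ ≤ r) : Γ ≤ r := by
  rw [← inf_eq_left.2 h, inf_sup_left]
  exact sup_le (H₁ _ inf_le_left inf_le_right) (H₂ _ inf_le_left inf_le_right)

theorem le_himp_of {Γ p q : 𝔹} (H : ∀ Δ ≤ Γ, Δ ≤ p → Δ ≤ q) : Γ ≤ p ⇨ q :=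
  le_himp_iff.2 (H _ inf_le_left inf_le_right)

theorem le_of_le_himp {Γ p q : 𝔹} (h : Γ ≤ p ⇨ q) (hp : Γ ≤ p) : Γ ≤ q :=
  (le_inf h hp).trans himp_inf_le

theorem le_forall_himp {ι : Sort*} {Γ : 𝔹} {p q : ι → 𝔹} (h : Γ ≤ ⨅ i, p i ⇨ q i) (i : ι)
    (hp : Γ ≤ p i) : Γ ≤ q i :=
  le_of_le_himp (h.trans (iInf_le _ i)) hp

/-- Under the countable chain condition, a matrix of truth values whose rows are antichains and
which has more columns than rows has a column with supremum `⊥`. -/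
theorem CCC.eq_bot_of_forall_le_iSup (h : CCC 𝔹) {ι J : Type u} (hι : max #ι ℵ₀ < #J)
    (b : ι → J → 𝔹) (hb : ∀ i j j', j ≠ j' → b i j ⊓ b i j' = ⊥) {Γ : 𝔹}
    (hΓ : ∀ j, Γ ≤ ⨆ i, b i j) : Γ = ⊥ := by
  have hcount : ∀ i, {j | b i j ≠ ⊥}.Countable := by
    intro i
    -- The CCC counts elements of `𝔹`, not indices; a nonzero value cannot repeat in a row, since it
    -- would be disjoint from itself.
    have hinj : Set.InjOn (b i) {j | b i j ≠ ⊥} := by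
      intro j hj j' _ e
      by_contra hne
      have := hb i j j' hne
      rw [← e, inf_idem] at this
      exact hj this
    refine Set.countable_of_injective_of_countable_image hinj (h _ ?_)
    rintro _ ⟨j, -, rfl⟩ _ ⟨j', -, rfl⟩ hne
    exact hb i j j' fun e => hne (by rw [e])
  have hU : #(⋃ i, {j | b i j ≠ ⊥} : Set J) < #J := by
    refine ((mk_iUnion_le _).trans ?_).trans_lt hι
    refine (mul_le_mul_right
      (ciSup_le' fun i => le_aleph0_iff_set_countable.2 (hcount i)) _).trans ?_
    refine (mul_le_max _ _).trans ?_
    simp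
  -- At most `#ι * ℵ₀ < #J` columns contain a nonzero entry, so some column vanishes.
  obtain ⟨j, hj⟩ : ∃ j, j ∉ ⋃ i, {j | b i j ≠ ⊥} := by
    by_contra! hall
    rw [Set.eq_univ_of_forall hall, mk_univ] at hU
    exact hU.ne rfl
  rw [eq_bot_iff]
  refine (hΓ j).trans (iSup_le fun i => ?_)
  by_contra hi
  exact hj (Set.mem_iUnion.2 ⟨i, fun e => hi e.le⟩)

end Calculus

/-! ### Basic facts on Boolean-valued sets -/

namespace BSet

variable {𝔹 : Type u} [CompleteBooleanAlgebra 𝔹] {Γ : 𝔹} {x y z x' y' : BSet 𝔹}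

theorem le_bvEq_symm (h : Γ ≤ bvEq x y) : Γ ≤ bvEq y x := h.trans (bvEq_symm x y).le

theorem le_bvEq_trans (h : Γ ≤ bvEq x y) (h' : Γ ≤ bvEq y z) : Γ ≤ bvEq x z :=
  (le_inf h h').trans (bvEq_trans x y z)

theorem le_mem_congr (h : Γ ≤ mem x y) (hx : Γ ≤ bvEq x x') (hy : Γ ≤ bvEq y y') :
    Γ ≤ mem x' y' :=
  (le_inf hx ((le_inf hy h).trans (mem_congr_right _ _ _))).trans (mem_congr_left _ _ _)

theorem le_bvEq_refl : Γ ≤ bvEq x x := le_top.trans (bvEq_refl x).ge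

theorem le_bvEq_pair (hx : Γ ≤ bvEq x x') (hy : Γ ≤ bvEq y y') :
    Γ ≤ bvEq (pair x y) (pair x' y') :=
  (le_inf hx hy).trans (pair_congr _ _ _ _)

theorem le_mem_of_subset (h : Γ ≤ subset x y) (hz : Γ ≤ mem z x) : Γ ≤ mem z y := by
  rw [subset_eq] at h
  exact le_forall_himp h z hz

/-! ### Kuratowski pairs -/

theorem le_mem_upair : Γ ≤ mem z (upair x y) ↔ Γ ≤ bvEq z x ⊔ bvEq z y := by rw [mem_upair]

theorem le_mem_upair_left : Γ ≤ mem x (upair x y) :=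
  le_mem_upair.2 (le_sup_of_le_left le_bvEq_refl)

theorem le_mem_upair_right : Γ ≤ mem y (upair x y) :=
  le_mem_upair.2 (le_sup_of_le_right le_bvEq_refl)

theorem le_bvEq_of_mem_singleton (h : Γ ≤ mem z (upair x x)) : Γ ≤ bvEq z x := by
  rwa [mem_upair, sup_idem] at h

/-- The singleton `{x}` equals `{x'}` or `{x', y'}`; either way `x'` belongs to `{x}`. -/
theorem le_bvEq_left_of_pair (h : Γ ≤ bvEq (pair x y) (pair x' y')) : Γ ≤ bvEq x x' := by
  have h1 : Γ ≤ mem (upair x x) (pair x' y') :=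
    le_mem_congr le_mem_upair_left le_bvEq_refl h
  refine le_of_le_sup (le_mem_upair.1 h1) ?_ ?_ <;>
  · intro Δ _ hΔ
    exact le_bvEq_symm (le_bvEq_of_mem_singleton
      (le_mem_congr le_mem_upair_left le_bvEq_refl (le_bvEq_symm hΔ)))

theorem le_or_of_pair (h : Γ ≤ bvEq (pair x y) (pair x' y')) : Γ ≤ bvEq y x' ⊔ bvEq y y' := by
  have h1 : Γ ≤ mem (upair x y) (pair x' y') :=
    le_mem_congr le_mem_upair_right le_bvEq_refl h
  refine le_of_le_sup (le_mem_upair.1 h1) ?_ ?_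
  · intro Δ _ hΔ
    exact le_sup_of_le_left (le_bvEq_of_mem_singleton
      (le_mem_congr le_mem_upair_right le_bvEq_refl hΔ))
  · intro Δ _ hΔ
    exact le_mem_upair.1 (le_mem_congr le_mem_upair_right le_bvEq_refl hΔ)

/-- The only delicate case is `y = x'`. By symmetry `y' = x` or `y' = y`, and in the former case `y'
= x = x' = y`. -/
theorem le_bvEq_right_of_pair (h : Γ ≤ bvEq (pair x y) (pair x' y')) : Γ ≤ bvEq y y' := by
  refine le_of_le_sup (le_or_of_pair h) ?_ fun Δ _ hΔ => hΔ
  intro Δ hΔ hyx'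
  refine le_of_le_sup (hΔ.trans (le_or_of_pair (le_bvEq_symm h))) ?_
    fun _ _ h' => le_bvEq_symm h'
  intro Δ' hΔ' hy'x
  have hxx := (hΔ'.trans hΔ).trans (le_bvEq_left_of_pair h)
  exact le_bvEq_trans (hΔ'.trans hyx') (le_bvEq_symm (le_bvEq_trans hy'x hxx))

/-- Foundation: a set with an element has an `∈`-minimal element. -/
theorem mem_le_exists_minimal (x y : BSet 𝔹) :
    mem y x ≤ ⨆ z : BSet 𝔹, mem z x ⊓ ⨅ w : BSet 𝔹, mem w x ⇨ (mem w z ⇨ ⊥) := by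
  induction y with
  | mk α A B ih =>
    set T := ⨆ z : BSet 𝔹, mem z x ⊓ ⨅ w : BSet 𝔹, mem w x ⇨ (mem w z ⇨ ⊥)
    set y : BSet 𝔹 := mk α A B
    -- Argue by contradiction, below `Tᶜ`. There `y` itself is minimal: a common element of `x` and
    -- `y` equals some `A a`, and the induction hypothesis for `A a` yields `T`.
    suffices H : mem y x ⊓ Tᶜ ≤ T by
      rw [← sdiff_eq, sdiff_le_iff, sup_idem] at H
      exact H
    suffices H : mem y x ⊓ Tᶜ ≤ ⨅ w : BSet 𝔹, mem w x ⇨ (mem w y ⇨ ⊥) from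
      (le_inf inf_le_left H).trans (le_iSup_of_le y le_rfl)
    refine le_iInf fun w => le_himp_of fun Δ hΔ hwx => le_himp_of fun Δ' hΔ' hwy => ?_
    refine le_of_le_iSup hwy fun a Δ'' hΔ'' ha => ?_
    have h1 : Δ'' ≤ T := (le_mem_congr ((hΔ''.trans hΔ').trans hwx) (ha.trans inf_le_right)
      le_bvEq_refl).trans (ih a)
    have h2 : Δ'' ≤ Tᶜ := ((hΔ''.trans hΔ').trans hΔ).trans inf_le_right
    exact (le_inf h1 h2).trans (inf_compl_self _).le

theorem compl_bvEq_empty_le (x : BSet 𝔹) : (bvEq x empty)ᶜ ≤ ⨆ a : x.idx, x.bval a := by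
  rw [compl_le_iff_compl_le, compl_iSup]
  refine bvEq_of_subset (fun z => ?_) fun z => ?_
  · refine le_of_le_iSup (inf_le_right : _ ≤ mem z x) fun a Δ hΔ ha => ?_
    have h1 : Δ ≤ (x.bval a)ᶜ := (hΔ.trans inf_le_left).trans (iInf_le _ a)
    exact ((le_inf (ha.trans inf_le_left) h1).trans (inf_compl_self _).le).trans bot_le
  · exact inf_le_right.trans (iSup_le fun a => nomatch a)

/-! ### Canonical names -/

theorem mem_check (x : BSet 𝔹) (z : PSet.{u}) :
    mem x (check z) = ⨆ a : z.Type, bvEq x (check (z.Func a)) := by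
  cases z
  simp only [mem, check]
  exact iSup_congr fun a => top_inf_eq _

theorem bvEq_check_of_equiv {x y : PSet.{u}} (h : x.Equiv y) :
    bvEq (check x) (check y) = (⊤ : 𝔹) := by
  induction x generalizing y with
  | mk α A ih =>
    cases y with
    | mk α' A' =>
      simp only [check, bvEq, eq_top_iff]
      refine le_inf (le_iInf fun a => le_himp_of fun Δ _ _ => ?_)
        (le_iInf fun a' => le_himp_of fun Δ _ _ => ?_)
      · obtain ⟨a', ha'⟩ := h.1 a
        exact le_iSup_of_le a' (by rw [ih a ha']; simp)
      · obtain ⟨a, ha⟩ := h.2 a'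
        exact le_iSup_of_le a (by rw [ih a ha]; simp)

/-- With `bvEq_check_of_equiv`, equality of canonical names is decided in the ground universe, so
case splits on indices can be made outside `𝔹`. -/
theorem bvEq_check_of_not_equiv {x y : PSet.{u}} (h : ¬ x.Equiv y) :
    bvEq (check x) (check y) = (⊥ : 𝔹) := by
  induction x generalizing y with
  | mk α A ih =>
    cases y with
    | mk α' A' =>
      have h' : (∃ a, ∀ b, ¬ (A a).Equiv (A' b)) ∨ ∃ b, ∀ a, ¬ (A a).Equiv (A' b) := by
        by_contra! H
        exact h ⟨H.1, H.2⟩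
      simp only [check, bvEq, eq_bot_iff]
      rcases h' with ⟨a, ha⟩ | ⟨b, hb⟩
      · refine inf_le_left.trans ((iInf_le _ a).trans ?_)
        simp [ih a (ha _)]
      · refine inf_le_right.trans ((iInf_le _ b).trans ?_)
        simp [ih _ (hb _)]

theorem mem_check_of_mem {x y : PSet.{u}} (h : x ∈ y) : mem (check x) (check y) = (⊤ : 𝔹) := by
  obtain ⟨b, hb⟩ := PSet.mem_def.1 h
  rw [mem_check, eq_top_iff]
  exact le_iSup_of_le b (bvEq_check_of_equiv hb).ge

theorem le_of_mem_check {r : 𝔹} {z : PSet.{u}} (h : Γ ≤ mem x (check z))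
    (H : ∀ a : z.Type, ∀ Δ ≤ Γ, Δ ≤ bvEq x (check (z.Func a)) → Δ ≤ r) : Γ ≤ r :=
  le_of_le_iSup (h.trans (mem_check x z).le) H

/-- There is no surjection from a subset of `check z` onto a set with more than
`max #z ℵ₀` pairwise distinct elements. -/
theorem subset_inf_isSurjection_eq_bot (h : CCC 𝔹) {z : PSet.{u}} {J : Type u}
    (hJ : max #z.Type ℵ₀ < #J) (c : J → BSet 𝔹) (hc : ∀ j, mem (c j) y = ⊤)
    (hne : ∀ j j', j ≠ j' → bvEq (c j) (c j') = ⊥) (s f : BSet 𝔹) :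
    subset s (check z) ⊓ isSurjection s y f = ⊥ := by
  set Γ := subset s (check z) ⊓ isSurjection s y f
  have hs : Γ ≤ subset s (check z) := inf_le_left
  have hfun : Γ ≤ isFun s y f := inf_le_right.trans inf_le_left
  have honto : Γ ≤ isOnto s y f := inf_le_right.trans inf_le_right
  -- Entry `(a, j)` says that `a` lies in `s` and `f` sends it to `c j`. The factor `Γ` makes
  -- single-valuedness available inside a row; surjectivity puts `Γ` below each column supremum.
  refine h.eq_bot_of_forall_le_iSup hJ (fun a j => Γ ⊓ (mem (check (z.Func a)) s ⊓
    mem (pair (check (z.Func a)) (c j)) f)) (fun a j j' hjj => ?_) fun j => ?_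
  · rw [eq_bot_iff, ← hne j j' hjj]
    set Δ := (Γ ⊓ (mem (check (z.Func a)) s ⊓ mem (pair (check (z.Func a)) (c j)) f)) ⊓
      (Γ ⊓ (mem (check (z.Func a)) s ⊓ mem (pair (check (z.Func a)) (c j')) f))
    have hΔ : Δ ≤ Γ := inf_le_left.trans inf_le_left
    have h1 := (hΔ.trans hfun).trans (inf_le_right.trans inf_le_right)
    have h2 := le_forall_himp h1 (check (z.Func a))
      (inf_le_left.trans (inf_le_right.trans inf_le_left))
    have h3 := le_forall_himp h2 (c j) (le_top.trans (hc j).ge)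
    have h4 := le_forall_himp h3 (c j') (le_top.trans (hc j').ge)
    exact le_of_le_himp (le_of_le_himp h4 (inf_le_left.trans (inf_le_right.trans inf_le_right)))
      (inf_le_right.trans (inf_le_right.trans inf_le_right))
  · refine le_of_le_iSup (le_forall_himp honto (c j) (le_top.trans (hc j).ge))
      fun x Δ hΔ hx => ?_
    have hxs := hx.trans inf_le_left
    refine le_of_mem_check (le_mem_of_subset (hΔ.trans hs) hxs) fun a Δ' hΔ' ha => ?_
    refine le_iSup_of_le a (le_inf (hΔ'.trans hΔ) (le_inf ?_ ?_))
    · exact le_mem_congr (hΔ'.trans hxs) ha le_bvEq_refl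
    · exact le_mem_congr (hΔ'.trans (hx.trans inf_le_right)) (le_bvEq_pair ha le_bvEq_refl)
        le_bvEq_refl

theorem prec_eq_top_of_ccc (h : CCC 𝔹) {z : PSet.{u}} {J : Type u}
    (hJ : max #z.Type ℵ₀ < #J) (c : J → BSet 𝔹) (hc : ∀ j, mem (c j) y = ⊤)
    (hne : ∀ j j', j ≠ j' → bvEq (c j) (c j') = ⊥) : prec (check z) y = ⊤ := by
  simp [prec, subset_inf_isSurjection_eq_bot h hJ c hc hne]

/-! ### Von Neumann ordinals -/

/-- The elements are the sets of the smaller ordinals, and rank recovers each ordinal from its set.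
-/
theorem _root_.Ordinal.toPSet_func_injective (o : Ordinal.{u}) {i j : o.toPSet.Type}
    (h : (o.toPSet.Func i).Equiv (o.toPSet.Func j)) : i = j := by
  -- The indices have a type depending on `o.toPSet`, so the set is generalised before its defining
  -- equation is substituted.
  suffices H : ∀ p : PSet.{u}, p = ⟨o.ToType, fun a => (a : Ordinal).toPSet⟩ →
      ∀ i j : p.Type, (p.Func i).Equiv (p.Func j) → i = j from
    H _ (by rw [Ordinal.toPSet]) i j h
  rintro _ rfl i j h
  have := PSet.rank_congr h
  simp only [PSet.mk_func, Ordinal.rank_toPSet] at this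
  exact Ordinal.ToType.mk.symm.injective (Subtype.ext this)

theorem _root_.Cardinal.mk_toPSet_ord (κ : Cardinal.{u}) : #κ.ord.toPSet.Type = κ := by
  rw [Ordinal.type_toPSet]
  simp

theorem prec_checkCard_eq_top (h : CCC 𝔹) {z : PSet.{u}} {κ : Cardinal.{u}}
    (hκ : max #z.Type ℵ₀ < κ) : prec (check z) (checkCard κ) = (⊤ : 𝔹) :=
  prec_eq_top_of_ccc h (J := κ.ord.toPSet.Type) (by rwa [mk_toPSet_ord])
    (fun i => check (κ.ord.toPSet.Func i)) (fun i => mem_check_of_mem (PSet.func_mem _ i))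
    fun _ _ hij => bvEq_check_of_not_equiv fun e => hij (Ordinal.toPSet_func_injective _ e)

end BSet

/-! ### Truth values of formulas -/

namespace LZFC

open FirstOrder FirstOrder.Language

variable {𝔹 : Type u} [CompleteBooleanAlgebra 𝔹] {n : ℕ}

/-- The value of a term in the in-scope variables. -/
def val (s : Fin n → BSet 𝔹) (t : Tm n) : BSet 𝔹 :=
  (VB 𝔹).termVal (Sum.elim Empty.elim s) t

variable (s : Fin n → BSet 𝔹) (x : BSet 𝔹) (t t' : Tm n) (φ ψ : Fm n)

theorem val_up : val (Fin.snoc s x : Fin (n + 1) → BSet 𝔹) (up t) = val s t := by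
  unfold val up
  induction t with
  | var i =>
    rcases i with i | i
    · exact i.elim
    · simp [BStructure.termVal, Term.relabel]
  | func f ts ih =>
    simp only [BStructure.termVal, Term.relabel]
    congr 1
    funext i
    exact ih i

theorem val_last : val (Fin.snoc s x : Fin (n + 1) → BSet 𝔹) (last n) = x := by
  simp [val, last, BStructure.termVal]

theorem val_emptyT : val s emptyT = BSet.empty := rfl

theorem val_omegaT : val s omegaT = BSet.omega := rfl

theorem val_powersetT : val s (powersetT t) = BSet.powerset (val s t) := rfl

theorem val_pairT : val s (pairT t t') = BSet.pair (val s t) (val s t') := rfl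

theorem truth_memF : (VB 𝔹).truth (memF t t') s = BSet.mem (val s t) (val s t') := rfl

theorem truth_eqF : (VB 𝔹).truth (eqF t t') s = BSet.bvEq (val s t) (val s t') := rfl

theorem truth_imp : (VB 𝔹).truth (φ.imp ψ) s = (VB 𝔹).truth φ s ⇨ (VB 𝔹).truth ψ s := rfl

theorem truth_not : (VB 𝔹).truth φ.not s = (VB 𝔹).truth φ s ⇨ ⊥ := rfl

theorem truth_all (φ : Fm (n + 1)) :
    (VB 𝔹).truth φ.all s = ⨅ x, (VB 𝔹).truth φ (Fin.snoc s x) := rfl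

/-- Conjunction, disjunction and `∃` abbreviate formulas in `⊥`, `→` and `∀`; their expected values
come from the classical laws of `𝔹`. -/
theorem truth_inf : (VB 𝔹).truth (φ ⊓ ψ) s = (VB 𝔹).truth φ s ⊓ (VB 𝔹).truth ψ s := by
  change ((VB 𝔹).truth φ s ⇨ ((VB 𝔹).truth ψ s ⇨ ⊥)) ⇨ ⊥ = _
  rw [himp_himp, himp_bot, himp_bot, compl_compl, inf_comm]

theorem truth_sup : (VB 𝔹).truth (φ ⊔ ψ) s = (VB 𝔹).truth φ s ⊔ (VB 𝔹).truth ψ s := by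
  change ((VB 𝔹).truth φ s ⇨ ⊥) ⇨ (VB 𝔹).truth ψ s = _
  rw [himp_bot, himp_eq, compl_compl, sup_comm]

theorem truth_ex (φ : Fm (n + 1)) :
    (VB 𝔹).truth φ.ex s = ⨆ x, (VB 𝔹).truth φ (Fin.snoc s x) := by
  change (⨅ x, ((VB 𝔹).truth φ (Fin.snoc s x) ⇨ ⊥)) ⇨ ⊥ = _
  simp only [himp_bot, compl_iInf, compl_compl]

theorem truth_ballF (φ : Fm (n + 1)) : (VB 𝔹).truth (ballF t φ) s =
    ⨅ x, BSet.mem x (val s t) ⇨ (VB 𝔹).truth φ (Fin.snoc s x) := by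
  simp only [ballF, truth_all, truth_imp, truth_memF, val_last, val_up]

theorem truth_bexF (φ : Fm (n + 1)) : (VB 𝔹).truth (bexF t φ) s =
    ⨆ x, BSet.mem x (val s t) ⊓ (VB 𝔹).truth φ (Fin.snoc s x) := by
  simp only [bexF, truth_ex, truth_inf, truth_memF, val_last, val_up]

theorem truth_subsetF : (VB 𝔹).truth (subsetF t t') s = BSet.subset (val s t) (val s t') := by
  simp only [subsetF, truth_ballF, truth_memF, val_last, val_up, BSet.subset_eq]

theorem truth_funF (f : Tm n) : (VB 𝔹).truth (funF t t' f) s =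
    BSet.isFun (val s t) (val s t') (val s f) := by
  simp only [funF, truth_ballF, truth_bexF, truth_memF, truth_eqF, truth_inf, truth_imp, val_last,
    val_up, val_pairT, BSet.isFun]

theorem truth_ontoF (f : Tm n) : (VB 𝔹).truth (ontoF t t' f) s =
    BSet.isOnto (val s t) (val s t') (val s f) := by
  simp only [ontoF, truth_ballF, truth_bexF, truth_memF, val_last, val_up, val_pairT, BSet.isOnto]

theorem truth_leF : (VB 𝔹).truth (leF t t') s = ⨆ r : BSet 𝔹, ⨆ f : BSet 𝔹,
    BSet.subset r (val s t') ⊓ BSet.isSurjection r (val s t) f := by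
  simp only [leF, truth_ex, truth_inf, truth_subsetF, truth_funF, truth_ontoF, val_last, val_up,
    BSet.isSurjection]

/-- Foundation holds for every Boolean-valued set, so this conjunct of being an ordinal is
automatic. -/
theorem truth_wellFoundedF : (VB 𝔹).truth (wellFoundedF t) s = ⊤ := by
  simp only [wellFoundedF, truth_all, truth_imp, truth_not, truth_bexF, truth_ballF, truth_eqF,
    truth_memF, val_last, val_up, val_emptyT, himp_bot (BSet.bvEq _ _)]
  rw [eq_top_iff]
  refine le_iInf fun x => le_himp_of fun Δ _ _ => le_himp_of fun Δ' _ hne => ?_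
  refine (hne.trans (BSet.compl_bvEq_empty_le x)).trans (iSup_le fun a => ?_)
  exact (BSet.bval_le_mem x a).trans (BSet.mem_le_exists_minimal x (x.func a))

/-- Below a suitable context, every member of the name equals the name of a smaller ordinal, so
trichotomy and transitivity transfer from the ground ordinals. -/
theorem truth_ordF_check (o : Ordinal.{u}) (ht : val s t = BSet.check o.toPSet) :
    (VB 𝔹).truth (ordF t) s = ⊤ := by
  have hfunc (a : o.toPSet.Type) : ∃ b < o, (o.toPSet.Func a).Equiv b.toPSet :=
    Ordinal.mem_toPSet_iff.1 (PSet.func_mem _ a)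
  rw [ordF, truth_inf, truth_inf, truth_wellFoundedF, top_inf_eq, eq_top_iff]
  simp only [trichotomyF, transitiveF, truth_ballF, truth_subsetF, truth_sup, truth_eqF,
    truth_memF, val_last, val_up, ht]
  refine le_inf (le_iInf fun x => le_himp_of fun Δ _ hx => le_iInf fun y =>
    le_himp_of fun Δ' hΔ' hy => ?_) (le_iInf fun x => le_himp_of fun Δ _ hx => ?_)
  · refine BSet.le_of_mem_check (hΔ'.trans hx) fun a Δ₁ hΔ₁ ha => ?_
    refine BSet.le_of_mem_check (hΔ₁.trans hy) fun b Δ₂ hΔ₂ hb => ?_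
    replace ha := BSet.le_bvEq_symm (hΔ₂.trans ha)
    replace hb := BSet.le_bvEq_symm hb
    obtain ⟨i, hi, hai⟩ := hfunc a
    obtain ⟨j, hj, hbj⟩ := hfunc b
    rcases lt_trichotomy i j with hij | rfl | hij
    · refine le_sup_of_le_right (le_sup_of_le_left (BSet.le_mem_congr ?_ ha hb))
      refine le_top.trans (BSet.mem_check_of_mem ?_).ge
      exact (PSet.Mem.congr_right hbj).2 (Ordinal.mem_toPSet_iff.2 ⟨i, hij, hai⟩)
    · refine le_sup_of_le_left (BSet.le_bvEq_trans (BSet.le_bvEq_symm ha)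
        (BSet.le_bvEq_trans ?_ hb))
      exact le_top.trans (BSet.bvEq_check_of_equiv (hai.trans hbj.symm)).ge
    · refine le_sup_of_le_right (le_sup_of_le_right (BSet.le_mem_congr ?_ hb ha))
      refine le_top.trans (BSet.mem_check_of_mem ?_).ge
      exact (PSet.Mem.congr_right hai).2 (Ordinal.mem_toPSet_iff.2 ⟨j, hij, hbj⟩)
  · refine BSet.le_of_mem_check hx fun a Δ₁ hΔ₁ ha => ?_
    rw [BSet.subset_eq]
    refine le_iInf fun y => le_himp_of fun Δ₂ hΔ₂ hy => ?_
    refine BSet.le_of_mem_check (BSet.le_mem_congr hy BSet.le_bvEq_refl (hΔ₂.trans ha))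
      fun b Δ₃ hΔ₃ hb => BSet.le_mem_congr ?_ (BSet.le_bvEq_symm hb) BSet.le_bvEq_refl
    refine le_top.trans (BSet.mem_check_of_mem ?_).ge
    obtain ⟨i, hi, hai⟩ := hfunc a
    obtain ⟨j, hj, hbj⟩ := Ordinal.mem_toPSet_iff.1
      ((PSet.Mem.congr_right hai).1 (PSet.func_mem _ b))
    exact Ordinal.mem_toPSet_iff.2 ⟨j, hj.trans hi, hbj⟩

/-- If an ordinal of the ground universe is strictly between `ω` and `𝒫 ω`, then the continuum
hypothesis fails. -/
theorem forces_not_CH (o : Ordinal.{u})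
    (h₁ : BSet.prec BSet.omega (BSet.check o.toPSet) = (⊤ : 𝔹))
    (h₂ : BSet.prec (BSet.check o.toPSet) (BSet.powerset BSet.omega) = (⊤ : 𝔹)) :
    (VB 𝔹).Forces ⊤ CH.not := by
  simp only [BSet.prec, compl_eq_top] at h₁ h₂
  have hCH : (VB 𝔹).truth CH Fin.elim0 ≤ ⊥ := by
    rw [CH, truth_all]
    refine (iInf_le _ (BSet.check o.toPSet)).trans ?_
    -- At this instance the two disjuncts of CH are exactly the suprema that `h₁` and `h₂` declare
    -- to be `⊥`.
    rw [truth_imp, truth_ordF_check _ _ o (val_last _ _), top_himp, truth_sup, truth_leF, truth_leF,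
      val_last, val_powersetT, val_omegaT, h₁, h₂, sup_bot_eq]
  exact le_himp_iff.2 (inf_le_right.trans hCH)

end LZFC

/-! ### The Cohen algebra -/

namespace RO

variable {X : Type u} [TopologicalSpace X]

/-- The underlying set of a regular open set. -/
def toSet (U : RO X) : Set X := ((U : TopologicalSpace.Opens X) : Set X)

theorem isOpen_toSet (U : RO X) : IsOpen U.toSet := U.1.2

theorem le_iff_toSet {U V : RO X} : U ≤ V ↔ U.toSet ⊆ V.toSet := Iff.rfl

theorem eq_bot_of_toSet_eq_empty {U : RO X} (h : U.toSet = ∅) : U = ⊥ :=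
  le_bot_iff.1 (le_iff_toSet.2 h.subset)

/-- The regular open algebra of a Cantor cube has the countable chain condition: disjoint
nonempty open sets contain disjoint cylinders, which have positive measure. -/
theorem ccc_cantorCube (ι : Type u) : CCC (RO (ι → Bool)) := by
  intro A hA
  let μ : MeasureTheory.Measure (ι → Bool) :=
    MeasureTheory.Measure.infinitePi fun _ => (PMF.uniformOfFintype Bool).toMeasure
  have hcyl : ∀ U : RO (ι → Bool), U ≠ ⊥ → ∃ C : Set (ι → Bool), MeasurableSet C ∧
      C ⊆ U.toSet ∧ 0 < μ C := by
    intro U hU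
    obtain ⟨S, hS⟩ := Set.nonempty_iff_ne_empty.2 (mt eq_bot_of_toSet_eq_empty hU)
    obtain ⟨I, u, hu, hsub⟩ := isOpen_pi_iff.1 U.isOpen_toSet S hS
    refine ⟨(I : Set ι).pi fun i => {S i}, ?_, ?_, ?_⟩
    · exact MeasurableSet.pi I.countable_toSet fun i _ => measurableSet_singleton _
    · exact (Set.pi_mono fun i hi => Set.singleton_subset_iff.2 (hu i hi).2).trans hsub
    -- The cylinder's measure is a finite product of positive point masses.
    · rw [MeasureTheory.Measure.infinitePi_pi _ fun i _ => measurableSet_singleton _]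
      simp [pos_iff_ne_zero]
  choose! C hCm hCs hCp using hcyl
  have hcount : {U : ↥(A \ {⊥}) | 0 < μ (C U)}.Countable := by
    refine MeasureTheory.Measure.countable_meas_pos_of_disjoint_iUnion
      (fun U => hCm _ U.2.2) fun U V hUV => ?_
    refine Set.disjoint_of_subset (hCs _ U.2.2) (hCs _ V.2.2) ?_
    rw [Set.disjoint_iff_inter_eq_empty]
    -- Meets of regular open sets are plain intersections, so disjointness in the algebra is
    -- disjointness of sets.
    exact congrArg toSet (hA _ U.2.1 _ V.2.1 fun e => hUV (Subtype.ext e))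
  -- An antichain in the sense of `CCC` may contain `⊥`, which has no cylinder and is added back
  -- separately.
  refine ((hcount.image Subtype.val).union (Set.countable_singleton ⊥)).mono fun U hU => ?_
  by_cases h : U = ⊥
  · exact Or.inr h
  · exact Or.inl ⟨⟨U, hU, h⟩, hCp U h, rfl⟩

end RO

/-- Genericity of the Cohen reals: a basic neighbourhood inside `U` fixes finitely many coordinates,
so at any `n` not occurring in them the two reals can be made to disagree. -/
theorem exists_toSet_principalOpen_of_ne {ν ν' : aleph2.{u}.Type} (hν : ν ≠ ν') {U : BCohen.{u}}
    (hU : U ≠ ⊥) :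
    ∃ n, ∃ S ∈ U.toSet, S ∈ (principalOpen ν n).toSet ∧ S ∉ (principalOpen ν' n).toSet := by
  classical
  obtain ⟨S, hS⟩ := Set.nonempty_iff_ne_empty.2 (mt RO.eq_bot_of_toSet_eq_empty hU)
  obtain ⟨I, u, hu, hsub⟩ := isOpen_pi_iff.1 U.isOpen_toSet S hS
  obtain ⟨n, hn⟩ := Infinite.exists_notMem_finset (I.image Prod.snd)
  have hI : ∀ p ∈ I, p.2 ≠ n := fun p hp e => hn (Finset.mem_image.2 ⟨p, hp, e⟩)
  -- Only coordinates at level `n` change, none of them in `I`: there `ν` gets true and every other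
  -- index false.
  refine ⟨n, fun p => if p.2 = n then decide (p.1 = ν) else S p, hsub fun p hp => ?_, ?_, ?_⟩
  · simpa [hI p hp] using (hu p hp).2
  · change (if n = n then decide (ν = ν) else _) = true
    simp
  · change ¬ (if n = n then decide (ν' = ν) else _) = true
    simp [hν.symm]

theorem PSet.ofNat_not_equiv {m n : ℕ} (h : m ≠ n) :
    ¬ (PSet.ofNat.{u} m).Equiv (PSet.ofNat.{u} n) := by
  have hmem : ∀ {m n : ℕ}, m < n → PSet.ofNat.{u} m ∈ PSet.ofNat.{u} n := by
    intro m n hmn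
    induction n with
    | zero => omega
    | succ n ih =>
      rcases Nat.lt_succ_iff_lt_or_eq.1 hmn with h | rfl
      · exact PSet.mem_insert_of_mem _ (ih h)
      · exact PSet.mem_insert _ _
  intro e
  rcases lt_or_gt_of_ne h with h | h
  · exact PSet.mem_irrefl _ ((PSet.Mem.congr_right e).2 (hmem h))
  · exact PSet.mem_irrefl _ ((PSet.Mem.congr_right e).1 (hmem h))

theorem mem_check_cohenReal_le (ν : aleph2.{u}.Type) (n : ℕ) :
    BSet.mem (BSet.check (PSet.ofNat n)) (cohenReal ν) ≤ principalOpen ν n := by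
  refine iSup_le fun m : ULift ℕ => ?_
  change principalOpen ν m.down ⊓ BSet.bvEq _ (BSet.check (PSet.ofNat m.down)) ≤ _
  by_cases h : n = m.down
  · rw [h]
    exact inf_le_left
  · rw [BSet.bvEq_check_of_not_equiv (PSet.ofNat_not_equiv h)]
    exact inf_le_right.trans bot_le

/-- Where the two reals agree, `n` in the first forces `n` in the second. A nonzero value of the
equality would contain a point that violates this. -/
theorem bvEq_cohenReal {ν ν' : aleph2.{u}.Type} (hν : ν ≠ ν') :
    BSet.bvEq (cohenReal ν) (cohenReal ν') = ⊥ := by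
  by_contra hne
  obtain ⟨n, S, hS, hSν, hSν'⟩ := exists_toSet_principalOpen_of_ne hν hne
  have h : BSet.bvEq (cohenReal ν) (cohenReal ν') ⊓ principalOpen ν n ≤ principalOpen ν' n :=
    (BSet.bvEq_le_mem (cohenReal ν) (cohenReal ν') (ULift.up n)).trans
      (mem_check_cohenReal_le ν' n)
  exact hSν' (RO.le_iff_toSet.1 h ⟨hS, hSν⟩)

theorem mem_cohenReal_powerset_omega (ν : aleph2.{u}.Type) :
    BSet.mem (cohenReal ν) (BSet.powerset BSet.omega) = ⊤ := by
  rw [BSet.mem_powerset, eq_top_iff]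
  refine le_iInf fun n : ULift ℕ => le_himp_of fun Δ _ _ => ?_
  exact le_top.trans (BSet.bval_le_mem BSet.omega n)

/-- The name of the map that sends `ν` to its Cohen real. -/
noncomputable def cohenMap : BSet BCohen.{u} :=
  .mk aleph2.Type (fun ν => BSet.pair (BSet.check (aleph2.Func ν)) (cohenReal ν)) fun _ => ⊤

theorem mem_pair_cohenMap (ν : aleph2.{u}.Type) :
    BSet.mem (BSet.pair (BSet.check (aleph2.Func ν)) (cohenReal ν)) cohenMap = ⊤ :=
  top_le_iff.1 (BSet.bval_le_mem cohenMap ν)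

theorem le_of_mem_cohenMap {Γ r : BCohen.{u}} {p : BSet BCohen.{u}}
    (h : Γ ≤ BSet.mem p cohenMap)
    (H : ∀ ν, ∀ Δ ≤ Γ, Δ ≤ BSet.bvEq p (BSet.pair (BSet.check (aleph2.Func ν)) (cohenReal ν)) →
      Δ ≤ r) : Γ ≤ r :=
  le_of_le_iSup h fun ν Δ hΔ hp => H ν Δ hΔ (hp.trans inf_le_right)

/-- For single-valuedness, two pairs in the map come from indices `ν` and `ν'`. If these differ,
equating the first coordinates has value `⊥`. -/
theorem isFun_cohenMap :
    BSet.isFun (BSet.check aleph2.{u}) (BSet.powerset BSet.omega) cohenMap = ⊤ := by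
  rw [eq_top_iff]
  refine le_inf ?_ (le_inf ?_ ?_)
  · refine le_iInf fun p => le_himp_of fun Δ _ hp => le_of_mem_cohenMap hp fun ν Δ' _ hν => ?_
    refine le_iSup_of_le _ (le_inf ?_ (le_iSup_of_le _ (le_inf ?_ hν)))
    · exact le_top.trans (BSet.mem_check_of_mem (PSet.func_mem _ ν)).ge
    · exact le_top.trans (mem_cohenReal_powerset_omega ν).ge
  · refine le_iInf fun a => le_himp_of fun Δ _ ha => BSet.le_of_mem_check ha fun ν Δ' _ hν => ?_
    refine le_iSup_of_le (cohenReal ν) (le_inf ?_ ?_)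
    · exact le_top.trans (mem_cohenReal_powerset_omega ν).ge
    · exact BSet.le_mem_congr (le_top.trans (mem_pair_cohenMap ν).ge)
        (BSet.le_bvEq_pair (BSet.le_bvEq_symm hν) BSet.le_bvEq_refl) BSet.le_bvEq_refl
  · refine le_iInf fun a => le_himp_of fun _ _ _ => le_iInf fun b => le_himp_of fun _ _ _ =>
      le_iInf fun c => le_himp_of fun _ _ _ => le_himp_of fun Δ _ hb =>
      le_himp_of fun Δ' h' hc => ?_
    refine le_of_mem_cohenMap (h'.trans hb) fun ν Δ₁ h₁ hν => ?_
    refine le_of_mem_cohenMap (h₁.trans hc) fun ν' Δ₂ h₂ hν' => ?_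
    replace hν := h₂.trans hν
    by_cases e : ν = ν'
    · subst e
      exact BSet.le_bvEq_trans (BSet.le_bvEq_right_of_pair hν)
        (BSet.le_bvEq_symm (BSet.le_bvEq_right_of_pair hν'))
    · refine (BSet.le_bvEq_trans (BSet.le_bvEq_symm (BSet.le_bvEq_left_of_pair hν))
        (BSet.le_bvEq_left_of_pair hν')).trans ?_
      exact (BSet.bvEq_check_of_not_equiv fun h =>
        e (Ordinal.toPSet_func_injective _ h)).le.trans bot_le

/-- The mirror image of single-valuedness: distinct indices are now excluded by the second
coordinates, through `bvEq_cohenReal`. -/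
theorem isOneOne_cohenMap :
    BSet.isOneOne (BSet.check aleph2.{u}) (BSet.powerset BSet.omega) cohenMap = ⊤ := by
  rw [eq_top_iff]
  refine le_iInf fun a => le_himp_of fun _ _ _ => le_iInf fun a' => le_himp_of fun _ _ _ =>
    le_iInf fun b => le_himp_of fun _ _ _ => le_himp_of fun Δ _ ha =>
    le_himp_of fun Δ' h' ha' => ?_
  refine le_of_mem_cohenMap (h'.trans ha) fun ν Δ₁ h₁ hν => ?_
  refine le_of_mem_cohenMap (h₁.trans ha') fun ν' Δ₂ h₂ hν' => ?_
  replace hν := h₂.trans hν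
  by_cases e : ν = ν'
  · subst e
    exact BSet.le_bvEq_trans (BSet.le_bvEq_left_of_pair hν)
      (BSet.le_bvEq_symm (BSet.le_bvEq_left_of_pair hν'))
  · refine (BSet.le_bvEq_trans (BSet.le_bvEq_symm (BSet.le_bvEq_right_of_pair hν))
      (BSet.le_bvEq_right_of_pair hν')).trans ?_
    rw [bvEq_cohenReal e]
    exact bot_le

/-! ### Cardinal comparisons and the failure of CH -/

theorem prec_omega_aleph_one {𝔹 : Type u} [CompleteBooleanAlgebra 𝔹] (h : CCC 𝔹) :
    BSet.prec BSet.omega (BSet.checkCard (aleph 1)) = (⊤ : 𝔹) := by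
  refine BSet.prec_checkCard_eq_top h ?_
  have : #PSet.omega.{u}.Type = ℵ₀ := mk_eq_aleph0 (ULift ℕ)
  rw [this, max_self, ← aleph_zero]
  exact aleph_lt_aleph.2 zero_lt_one

/-- The counting argument applies directly to the `ℵ₂` Cohen reals as members of `𝒫 ω`, without
composing with the injection from `ℵ₂`. -/
theorem prec_aleph_one_powerset_omega :
    BSet.prec (BSet.checkCard (aleph 1)) (BSet.powerset BSet.omega) = (⊤ : BCohen.{u}) := by
  refine BSet.prec_eq_top_of_ccc (RO.ccc_cantorCube _) (J := aleph2.Type) ?_ cohenReal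
    mem_cohenReal_powerset_omega fun _ _ => bvEq_cohenReal
  rw [mk_toPSet_ord, aleph2, mk_toPSet_ord, max_eq_left (aleph0_le_aleph 1)]
  exact aleph_lt_aleph.2 one_lt_two

theorem mainTheorem3 :
    -- `¬ CH` has truth value `⊤` in the Boolean-valued universe over the Cohen algebra
    (VB BCohen.{u}).Forces ⊤ LZFC.CH.not ∧
    -- the map sending `ν` to its Cohen real is an injection from `ℵ₂`-check into `𝒫 ω`
    (∃ f : BSet BCohen.{u},
      BSet.isInjection (BSet.check aleph2) (BSet.powerset BSet.omega) f = ⊤ ∧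
      ∀ ν : aleph2.{u}.Type,
        BSet.mem (BSet.pair (BSet.check (aleph2.Func ν)) (cohenReal ν)) f = ⊤) ∧
    -- the Cohen algebra has the CCC, and `ω ≺ ℵ₁`-check `≺ ℵ₂`-check
    CCC BCohen.{u} ∧
    BSet.prec BSet.omega (BSet.checkCard (Cardinal.aleph 1)) = (⊤ : BCohen.{u}) ∧
    BSet.prec (BSet.checkCard (Cardinal.aleph 1)) (BSet.checkCard (Cardinal.aleph 2)) =
      (⊤ : BCohen.{u}) ∧
    -- the general form, for every complete Boolean algebra with the CCC
    (∀ (𝔹 : Type u) [CompleteBooleanAlgebra 𝔹], CCC 𝔹 →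
      ∀ κ₁ κ₂ : Cardinal.{u}, κ₁.IsRegular → κ₂.IsRegular → κ₁ < κ₂ →
        BSet.prec (BSet.checkCard κ₁) (BSet.checkCard κ₂) = (⊤ : 𝔹)) := by
  have general : ∀ (𝔹 : Type u) [CompleteBooleanAlgebra 𝔹], CCC 𝔹 →
      ∀ κ₁ κ₂ : Cardinal.{u}, κ₁.IsRegular → κ₂.IsRegular → κ₁ < κ₂ →
        BSet.prec (BSet.checkCard κ₁) (BSet.checkCard κ₂) = (⊤ : 𝔹) := by
    intro 𝔹 _ h κ₁ κ₂ h₁ _ hlt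
    refine BSet.prec_checkCard_eq_top h ?_
    rwa [mk_toPSet_ord, max_eq_left h₁.aleph0_le]
  have hccc : CCC BCohen.{u} := RO.ccc_cantorCube _
  -- The ordinal refuting CH is `ℵ₁` of the ground universe.
  refine ⟨LZFC.forces_not_CH _ (prec_omega_aleph_one hccc) prec_aleph_one_powerset_omega,
    ⟨cohenMap, ?_, mem_pair_cohenMap⟩, hccc, prec_omega_aleph_one hccc, ?_, general⟩
  · rw [BSet.isInjection, isFun_cohenMap, isOneOne_cohenMap, inf_top_eq]
  · exact BSet.prec_checkCard_eq_top hccc (by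
      rw [mk_toPSet_ord, max_eq_left (aleph0_le_aleph 1)]
      exact aleph_lt_aleph.2 one_lt_two)
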